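/- Let $n\ge 1$, let $\mathbf h=(h_1,\dots,h_n)$ have positive entries with $\sum_{k} h_k=1$, let $\boldsymbol\alpha=(\alpha_1,\dots,\alpha_n)$ satisfy $1\ge\alpha_1\ge\alpha_2\ge\cdots\ge\alpha_n\ge 0$, and let $\sigma>0$. Consider the channel $Y=\sum_{k=1}^n h_kX_k+Z$, where $Z\sim\mathcal N(0,\sigma^2)$ is independent of the input $\mathbf X=(X_1,\dots,X_n)$. Call $\mathbf X$ feasible if $0\le X_k\le 1$ almost surely and $\mathbb E[X_k]=\alpha_k$ for every $k$, call $S=\sum_{k=1}^n h_kX_k$ a feasible equivalent input if $\mathbf X$ is feasible, and let $$\mathsf C_{\mathrm E}(\mathbf h,\boldsymbol\alpha,\sigma)=\sup_{\mathbf X\text{ feasible}} I(\mathbf X;Y)$$ be the capacity of the channel in nats, where the supremum is over the laws of feasible inputs. Put $$\mathsf V_{\max}^{\mathrm E}(\mathbf h,\boldsymbol\alpha)=\sum_{i=1}^{n}\sum_{j=1}^{n}h_ih_j\bigl(\min\{\alpha_i,\alpha_j\}-\alpha_i\alpha_j\bigr).$$ Then $$\mathsf C_{\mathrm E}(\mathbf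 h,\boldsymbol\alpha,\sigma)\le\frac12\log\left(1+\frac{\mathsf V_{\max}^{\mathrm E}(\mathbf h,\boldsymbol\alpha)}{\sigma^2}\right),$$ where $\log$ is the natural logarithm, and $\mathsf V_{\max}^{\mathrm E}(\mathbf h,\boldsymbol\alpha)$ is the maximum of $\operatorname{Var}(S)$ over all feasible equivalent inputs $S$. Moreover, let $\bar S$ be the maximally convex distribution, which takes the values $0,\ h_1,\ h_1+h_2,\ \dots,\ h_1+\cdots+h_{n-1},\ 1$ with respective probabilities $1-\alpha_1,\ \alpha_1-\alpha_2,\ \dots,\ \alpha_{n-1}-\alpha_n,\ \alpha_n$. Then $\bar S$ has the law of a feasible equivalent input, $\operatorname{Var}(\bar S)=\mathsf V_{\max}^{\mathrm E}(\mathbf h,\boldsymbol\alpha)$, and every feasible equivalent input $S$ precedes $\bar S$ in the convex order, that is, $\mathbb E[f(S)]\le\mathbb E[f(\bar S)]$ for every convex $f:\mathbb R\to\mathbb R$ for which both expectations exist. -/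

import Mathlib

open MeasureTheory ProbabilityTheory

/-- Mutual information (in nats) of a pair of random variables with joint law `ρ`: the relative
entropy of the joint law with respect to the product of its marginals. -/
noncomputable def mutualInformation {A B : Type*} [MeasurableSpace A] [MeasurableSpace B]
    (ρ : Measure (A × B)) : ENNReal :=
  InformationTheory.klDiv ρ (ρ.fst.prod ρ.snd)

/-- The equivalent input `S = ∑ₖ hₖ xₖ`. -/
noncomputable def equivInput {n : ℕ} (h x : Fin n → ℝ) : ℝ := ∑ k, h k * x k

/-- Joint law of `(X, Y)`, where `Y = ∑ₖ hₖ Xₖ + Z`, the input `X` has law `P`, and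
`Z ∼ N(0, σ²)` is independent of `X`. -/
noncomputable def jointLaw {n : ℕ} (h : Fin n → ℝ) (σ : ℝ) (P : Measure (Fin n → ℝ)) :
    Measure ((Fin n → ℝ) × ℝ) :=
  (P.prod (gaussianReal 0 ⟨σ ^ 2, sq_nonneg σ⟩)).map (fun p => (p.1, equivInput h p.1 + p.2))

/-- `P` is the law of an input vector satisfying the equal-cost constraints
`0 ≤ Xₖ ≤ 1` and `E[Xₖ] = αₖ` for all `k`. -/
structure IsECFeasible {n : ℕ} (α : Fin n → ℝ) (P : Measure (Fin n → ℝ)) : Prop where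
  isProbabilityMeasure : IsProbabilityMeasure P
  mem_unit : ∀ᵐ x ∂P, ∀ k, x k ∈ Set.Icc (0 : ℝ) 1
  mean_eq : ∀ k, ∫ x, x k ∂P = α k

/-- Single-letter capacity of the channel under the equal-cost constraints. -/
noncomputable def ecCapacity {n : ℕ} (h α : Fin n → ℝ) (σ : ℝ) : ENNReal :=
  ⨆ (P : Measure (Fin n → ℝ)) (_ : IsECFeasible α P), mutualInformation (jointLaw h σ P)

/-- The laws of the feasible equivalent inputs `S = ∑ₖ hₖ Xₖ`. -/
def feasibleEquivInputs {n : ℕ} (h α : Fin n → ℝ) : Set (Measure ℝ) :=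
  {ν | ∃ P : Measure (Fin n → ℝ), IsECFeasible α P ∧ ν = P.map (equivInput h)}

/-- `∑ᵢ ∑ⱼ hᵢ hⱼ (min {αᵢ, αⱼ} - αᵢ αⱼ)`. -/
noncomputable def vMaxE {n : ℕ} (h α : Fin n → ℝ) : ℝ :=
  ∑ i, ∑ j, h i * h j * (min (α i) (α j) - α i * α j)

/-- The cumulative gain `h₁ + ⋯ + hₖ`. -/
noncomputable def cumGain {n : ℕ} (h : Fin n → ℝ) (k : ℕ) : ℝ :=
  ∑ i : Fin n with i.val < k, h i

/-- The sequence `1, α₁, …, αₙ, 0, 0, …`, indexed from `0`. -/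
noncomputable def extMean {n : ℕ} (α : Fin n → ℝ) : ℕ → ℝ
  | 0 => 1
  | k + 1 => if hk : k < n then α ⟨k, hk⟩ else 0

/-- The maximally convex distribution: masses `1 - α₁, α₁ - α₂, …, αₙ₋₁ - αₙ, αₙ` at the points
`0, h₁, h₁ + h₂, …, h₁ + ⋯ + hₙ`. -/
noncomputable def maxConvexLaw {n : ℕ} (h α : Fin n → ℝ) : Measure ℝ :=
  ∑ k ∈ Finset.range (n + 1),
    ENNReal.ofReal (extMean α k - extMean α (k + 1)) • Measure.dirac (cumGain h k)

/-- Convex order of laws on the real line. -/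
def ConvexOrderLE (μ ν : Measure ℝ) : Prop :=
  ∀ f : ℝ → ℝ, ConvexOn ℝ Set.univ f → Integrable f μ → Integrable f ν →
    ∫ s, f s ∂μ ≤ ∫ s, f s ∂ν

/-!
Convex order. Adding the coordinates in the order `1, …, n`, convexity bounds the increment of `f`
caused by `hₖ xₖ` by `xₖ (f (H + hₖ) - f H)`, where `H = h₁ + ⋯ + hₖ₋₁` is the largest position
from which the step can start. So on the unit cube `f (∑ₖ hₖ xₖ)` lies below an affine function of
`x` (`ConvexOn.equivInput_le`), whose expectation depends on the means `αₖ` only. Summation by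
parts (`sum_extMean_decrement_mul`) shows that this expectation is the integral of `f` under the
maximally convex law, and the latter is feasible, being the law of the equivalent input under the
comonotone coupling of Bernoulli variables (`comonotoneLaw`). Since all feasible equivalent inputs
have the same mean, the convex function `s ↦ (s - m)²` gives the extremality of the variance, and
a direct computation of the second moment, using `min (α i) (α j) = α (max i j)`, gives its value.

Capacity. By the chain rule for relative entropy, mutual information does not exceed the
divergence of the joint law from the product of the input law with any output law
(`mutualInformation_le_klDiv`). With the output law `N(m, σ² + V)`, where `m` is the common mean
and `V` the maximal variance, the log-density is quadratic in the input and the noise, and its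
expectation is `½ log (1 + V / σ²)` plus a term that is nonpositive because `Var S ≤ V`.
-/

/-! ### The maximally convex law -/

/-- Summation by parts for a weight sequence given by the decrements of `e`. -/
lemma sum_range_decrement_mul (e F : ℕ → ℝ) (m : ℕ) :
    ∑ k ∈ Finset.range (m + 1), (e k - e (k + 1)) * F k =
      e 0 * F 0 - e (m + 1) * F m +
        ∑ k ∈ Finset.range m, e (k + 1) * (F (k + 1) - F k) := by
  induction m with
  | zero => simp; ring
  | succ m ih => rw [Finset.sum_range_succ, ih, Finset.sum_range_succ]; ring

lemma extMean_succ_val {n : ℕ} (α : Fin n → ℝ) (k : Fin n) : extMean α (k + 1) = α k := by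
  simp [extMean]

lemma extMean_succ_self {n : ℕ} (α : Fin n → ℝ) : extMean α (n + 1) = 0 := by
  simp [extMean]

lemma extMean_succ_le {n : ℕ} {α : Fin n → ℝ} (hα_mem : ∀ k, α k ∈ Set.Icc (0 : ℝ) 1)
    (hα_anti : Antitone α) (k : ℕ) : extMean α (k + 1) ≤ extMean α k := by
  rcases k with _ | k
  · by_cases hk : 0 < n
    · simpa [extMean, hk] using (hα_mem ⟨0, hk⟩).2
    · simp [extMean, hk]
  · by_cases hk : k + 1 < n
    · have hk' : k < n := by omega
      simp only [extMean, hk, hk', dif_pos]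
      exact hα_anti (by simp)
    · by_cases hk' : k < n
      · simpa [extMean, hk, hk'] using (hα_mem ⟨k, hk'⟩).1
      · simp [extMean, hk, hk']

/-- Expectations under the maximally convex law, summed by parts. -/
lemma sum_extMean_decrement_mul {n : ℕ} (α : Fin n → ℝ) (F : ℕ → ℝ) :
    ∑ k ∈ Finset.range (n + 1), (extMean α k - extMean α (k + 1)) * F k =
      F 0 + ∑ k : Fin n, α k * (F (k + 1) - F k) := by
  rw [sum_range_decrement_mul, extMean_succ_self, Finset.sum_range]
  simp only [extMean_succ_val]
  simp [extMean]

lemma sum_extMean_decrement_indicator {n : ℕ} (α : Fin n → ℝ) (i : Fin n) :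
    ∑ k ∈ Finset.range (n + 1), (extMean α k - extMean α (k + 1)) *
      (if i.val < k then 1 else 0) = α i := by
  rw [sum_extMean_decrement_mul α (fun k => if i.val < k then 1 else 0),
    Finset.sum_eq_single i]
  · simp
  · intro k _ hk
    have : i.val ≠ k.val := fun h => hk (Fin.ext h.symm)
    have : i.val < k.val + 1 ↔ i.val < k.val := by omega
    simp [this]
  · simp

lemma sum_extMean_decrement_indicator_mul {n : ℕ} {α : Fin n → ℝ} (hα_anti : Antitone α)
    (i j : Fin n) :
    ∑ k ∈ Finset.range (n + 1), (extMean α k - extMean α (k + 1)) *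
      ((if i.val < k then 1 else 0) * (if j.val < k then 1 else 0)) = min (α i) (α j) := by
  rw [← hα_anti.map_max, ← sum_extMean_decrement_indicator α (max i j)]
  refine Finset.sum_congr rfl fun k _ => ?_
  have : (max i j).val < k ↔ i.val < k ∧ j.val < k := by
    rcases le_total i j with hij | hij
    · rw [max_eq_right hij]; have : i.val ≤ j.val := hij; omega
    · rw [max_eq_left hij]; have : j.val ≤ i.val := hij; omega
  simp only [this, ite_and]
  split_ifs <;> simp

/-- The law on `{0, 1}ⁿ` charging the vectors `(1, …, 1, 0, …, 0)` with `k` ones by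
`αₖ - αₖ₊₁`, where `α₀ = 1` and `αₙ₊₁ = 0`: the comonotone coupling of Bernoulli variables with means `αᵢ`. -/
noncomputable def comonotoneLaw {n : ℕ} (α : Fin n → ℝ) : Measure (Fin n → ℝ) :=
  ∑ k ∈ Finset.range (n + 1),
    ENNReal.ofReal (extMean α k - extMean α (k + 1)) •
      Measure.dirac (fun i : Fin n => if i.val < k then (1 : ℝ) else 0)

lemma equivInput_prefix {n : ℕ} (h : Fin n → ℝ) (k : ℕ) :
    equivInput h (fun i : Fin n => if i.val < k then (1 : ℝ) else 0) = cumGain h k := by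
  simp [equivInput, cumGain, Finset.sum_filter]

lemma measurable_equivInput {n : ℕ} (h : Fin n → ℝ) : Measurable (equivInput h) := by
  unfold equivInput
  fun_prop

lemma map_comonotoneLaw {n : ℕ} (h α : Fin n → ℝ) :
    (comonotoneLaw α).map (equivInput h) = maxConvexLaw h α := by
  unfold comonotoneLaw maxConvexLaw
  rw [← Measure.mapₗ_apply_of_measurable (measurable_equivInput h), map_sum]
  refine Finset.sum_congr rfl fun k _ => ?_
  rw [Measure.mapₗ_apply_of_measurable (measurable_equivInput h), Measure.map_smul,
    Measure.map_dirac' (measurable_equivInput h), equivInput_prefix]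

/-- Expectation under a finite sum of weighted point masses with nonnegative weights. -/
lemma integral_sum_ofReal_smul_dirac {ι A : Type*} [MeasurableSpace A]
    [MeasurableSingletonClass A] (s : Finset ι) {w : ι → ℝ} (hw : ∀ k, 0 ≤ w k)
    (a : ι → A) (f : A → ℝ) :
    ∫ x, f x ∂(∑ k ∈ s, ENNReal.ofReal (w k) • Measure.dirac (a k)) = ∑ k ∈ s, w k * f (a k) := by
  rw [integral_finsetSum_measure]
  · simp [hw]
  · intro k _
    exact (integrable_dirac (by simp)).smul_measure ENNReal.ofReal_ne_top

lemma integral_maxConvexLaw {n : ℕ} (h : Fin n → ℝ) {α : Fin n → ℝ}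
    (hα_mem : ∀ k, α k ∈ Set.Icc (0 : ℝ) 1) (hα_anti : Antitone α) (f : ℝ → ℝ) :
    ∫ s, f s ∂(maxConvexLaw h α) =
      ∑ k ∈ Finset.range (n + 1), (extMean α k - extMean α (k + 1)) * f (cumGain h k) :=
  integral_sum_ofReal_smul_dirac _
    (fun k => sub_nonneg.2 (extMean_succ_le hα_mem hα_anti k)) _ f

lemma isECFeasible_comonotoneLaw {n : ℕ} {α : Fin n → ℝ}
    (hα_mem : ∀ k, α k ∈ Set.Icc (0 : ℝ) 1) (hα_anti : Antitone α) :
    IsECFeasible α (comonotoneLaw α) := by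
  have hw : ∀ k, 0 ≤ extMean α k - extMean α (k + 1) :=
    fun k => sub_nonneg.2 (extMean_succ_le hα_mem hα_anti k)
  refine ⟨⟨?_⟩, ?_, fun i => ?_⟩
  · have := sum_extMean_decrement_mul α (fun _ => 1)
    simp only [mul_one, sub_self, mul_zero, Finset.sum_const_zero, add_zero] at this
    simp [comonotoneLaw, ← ENNReal.ofReal_sum_of_nonneg fun k _ => hw k, this]
  · rw [comonotoneLaw, ae_finsetSum_measure_iff]
    refine fun k _ => Measure.ae_smul_measure ?_ _
    rw [ae_dirac_eq]
    change ∀ i : Fin n, (if i.val < k then (1 : ℝ) else 0) ∈ Set.Icc (0 : ℝ) 1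
    intro i
    split_ifs <;> simp
  · rw [comonotoneLaw, integral_sum_ofReal_smul_dirac _ hw, sum_extMean_decrement_indicator]

lemma maxConvexLaw_mem_feasibleEquivInputs {n : ℕ} (h : Fin n → ℝ) {α : Fin n → ℝ}
    (hα_mem : ∀ k, α k ∈ Set.Icc (0 : ℝ) 1) (hα_anti : Antitone α) :
    maxConvexLaw h α ∈ feasibleEquivInputs h α :=
  ⟨comonotoneLaw α, isECFeasible_comonotoneLaw hα_mem hα_anti, (map_comonotoneLaw h α).symm⟩

/-- The second moment of the maximally convex law about the common mean `∑ₖ hₖ αₖ`. -/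
lemma integral_sub_sq_maxConvexLaw {n : ℕ} (h : Fin n → ℝ) {α : Fin n → ℝ}
    (hα_mem : ∀ k, α k ∈ Set.Icc (0 : ℝ) 1) (hα_anti : Antitone α) :
    ∫ s, (s - ∑ k, h k * α k) ^ 2 ∂(maxConvexLaw h α) = vMaxE h α := by
  rw [integral_maxConvexLaw h hα_mem hα_anti]
  have expand : ∀ k, (cumGain h k - ∑ i, h i * α i) ^ 2 =
      ∑ i, ∑ j, h i * h j * (((if i.val < k then 1 else 0) * (if j.val < k then 1 else 0)) -
        α j * (if i.val < k then 1 else 0) - α i * (if j.val < k then 1 else 0) +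
        α i * α j) := by
    intro k
    rw [← equivInput_prefix, equivInput, ← Finset.sum_sub_distrib, sq, Finset.sum_mul_sum]
    refine Finset.sum_congr rfl fun i _ => Finset.sum_congr rfl fun j _ => ?_
    ring
  simp_rw [expand, Finset.mul_sum]
  rw [Finset.sum_comm]
  simp_rw [Finset.sum_comm (s := Finset.range (n + 1))]
  unfold vMaxE
  refine Finset.sum_congr rfl fun i _ => Finset.sum_congr rfl fun j _ => ?_
  have h1 := sum_extMean_decrement_mul α (fun _ => 1)
  simp only [mul_one, sub_self, mul_zero, Finset.sum_const_zero, add_zero] at h1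
  calc _ = h i * h j * (∑ k ∈ Finset.range (n + 1), (extMean α k - extMean α (k + 1)) *
          ((if i.val < k then 1 else 0) * (if j.val < k then 1 else 0))
        - α j * ∑ k ∈ Finset.range (n + 1), (extMean α k - extMean α (k + 1)) *
          (if i.val < k then 1 else 0)
        - α i * ∑ k ∈ Finset.range (n + 1), (extMean α k - extMean α (k + 1)) *
          (if j.val < k then 1 else 0)
        + α i * α j * ∑ k ∈ Finset.range (n + 1), (extMean α k - extMean α (k + 1))) := by
        simp only [Finset.mul_sum, ← Finset.sum_sub_distrib, ← Finset.sum_add_distrib]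
        exact Finset.sum_congr rfl fun k _ => by ring
    _ = _ := by
        rw [sum_extMean_decrement_indicator_mul hα_anti, sum_extMean_decrement_indicator,
          sum_extMean_decrement_indicator, h1]
        ring

/-! ### Convex order -/

/-- Increments of a convex function over intervals of equal length increase to the right. -/
lemma ConvexOn.add_sub_le_add_sub {f : ℝ → ℝ} (hf : ConvexOn ℝ Set.univ f) {s t a : ℝ}
    (hst : s ≤ t) (ha : 0 ≤ a) : f (s + a) - f s ≤ f (t + a) - f t := by
  rcases (add_nonneg (sub_nonneg.2 hst) ha).eq_or_lt with hD | hD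
  · obtain rfl : s = t := by linarith
    rfl
  have h0 : (t - s) / (t - s + a) + a / (t - s + a) = 1 := by field_simp
  have h1 := hf.2 (Set.mem_univ s) (Set.mem_univ (t + a))
    (div_nonneg (sub_nonneg.2 hst) hD.le) (div_nonneg ha hD.le) h0
  have h2 := hf.2 (Set.mem_univ s) (Set.mem_univ (t + a))
    (div_nonneg ha hD.le) (div_nonneg (sub_nonneg.2 hst) hD.le) (by rw [add_comm, h0])
  simp only [smul_eq_mul] at h1 h2
  have e1 : (t - s) / (t - s + a) * s + a / (t - s + a) * (t + a) = s + a := by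
    field_simp; ring
  have e2 : a / (t - s + a) * s + (t - s) / (t - s + a) * (t + a) = t := by
    field_simp; ring
  rw [e1] at h1
  rw [e2] at h2
  linear_combination h1 + h2 + (f s + f (t + a)) * h0

lemma Fin.sum_filter_val_lt_succ {n : ℕ} (g : Fin n → ℝ) {m : ℕ} (hm : m < n) :
    ∑ i : Fin n with i.val < m + 1, g i = ∑ i : Fin n with i.val < m, g i + g ⟨m, hm⟩ := by
  have : Finset.univ.filter (fun i : Fin n => i.val < m + 1) =
      insert ⟨m, hm⟩ (Finset.univ.filter fun i : Fin n => i.val < m) := by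
    ext i
    simp only [Finset.mem_filter, Finset.mem_univ, true_and, Finset.mem_insert, Fin.ext_iff]
    omega
  rw [this, Finset.sum_insert (by simp), add_comm]

/-- A convex function of `∑ₖ hₖ xₖ` is dominated on the unit cube by an affine function of `x`
agreeing with it at the vectors `(1, …, 1, 0, …, 0)`. -/
lemma ConvexOn.equivInput_le {n : ℕ} {h x : Fin n → ℝ} {f : ℝ → ℝ}
    (hf : ConvexOn ℝ Set.univ f) (hh : ∀ k, 0 ≤ h k) (hx : ∀ k, x k ∈ Set.Icc (0 : ℝ) 1) :
    f (equivInput h x) ≤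
      f 0 + ∑ k : Fin n, x k * (f (cumGain h (k + 1)) - f (cumGain h k)) := by
  have key : ∀ m ≤ n, f (∑ i : Fin n with i.val < m, h i * x i) ≤
      f 0 + ∑ k : Fin n with k.val < m, x k * (f (cumGain h (k + 1)) - f (cumGain h k)) := by
    intro m
    induction m with
    | zero => simp
    | succ m ih =>
      intro hm
      replace hm : m < n := hm
      rw [Fin.sum_filter_val_lt_succ _ hm, Fin.sum_filter_val_lt_succ _ hm]
      set T := ∑ i : Fin n with i.val < m, h i * x i with hT
      have hTle : T ≤ cumGain h m :=
        Finset.sum_le_sum fun i _ => mul_le_of_le_one_right (hh i) (hx i).2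
      have hcum : cumGain h (m + 1) = cumGain h m + h ⟨m, hm⟩ :=
        Fin.sum_filter_val_lt_succ _ hm
      -- Only the fraction `x m` of the step `h m` is taken, which by convexity costs at most the
      -- fraction `x m` of the full increment from `T`; that increment grows as `T` moves right.
      have h1 := hf.2 (Set.mem_univ T) (Set.mem_univ (T + h ⟨m, hm⟩))
        (sub_nonneg.2 (hx ⟨m, hm⟩).2) (hx ⟨m, hm⟩).1 (by ring)
      simp only [smul_eq_mul] at h1
      have e : (1 - x ⟨m, hm⟩) * T + x ⟨m, hm⟩ * (T + h ⟨m, hm⟩) = T + h ⟨m, hm⟩ * x ⟨m, hm⟩ := by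
        ring
      rw [e] at h1
      have h2 := mul_le_mul_of_nonneg_left (hf.add_sub_le_add_sub hTle (hh ⟨m, hm⟩))
        (hx ⟨m, hm⟩).1
      rw [hcum]
      linarith [ih hm.le]
  simpa [equivInput] using key n le_rfl

lemma IsECFeasible.integrable_apply {n : ℕ} {α : Fin n → ℝ} {P : Measure (Fin n → ℝ)}
    (hP : IsECFeasible α P) (k : Fin n) : Integrable (fun x => x k) P := by
  have := hP.isProbabilityMeasure
  refine Integrable.of_bound (measurable_pi_apply k).aestronglyMeasurable 1 ?_
  filter_upwards [hP.mem_unit] with x hx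
  rw [Real.norm_of_nonneg (hx k).1]
  exact (hx k).2

lemma IsECFeasible.integral_equivInput {n : ℕ} {α : Fin n → ℝ} {P : Measure (Fin n → ℝ)}
    (hP : IsECFeasible α P) (h : Fin n → ℝ) :
    ∫ x, equivInput h x ∂P = ∑ k, h k * α k := by
  unfold equivInput
  rw [integral_finsetSum _ fun k _ => (hP.integrable_apply k).const_mul (h k)]
  simp_rw [integral_const_mul, hP.mean_eq]

lemma IsECFeasible.memLp_equivInput {n : ℕ} {α : Fin n → ℝ} {P : Measure (Fin n → ℝ)}
    (hP : IsECFeasible α P) (h : Fin n → ℝ) (p : ENNReal) :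
    MemLp (equivInput h) p P := by
  have := hP.isProbabilityMeasure
  refine MemLp.of_bound (measurable_equivInput h).aestronglyMeasurable (∑ k, |h k|) ?_
  filter_upwards [hP.mem_unit] with x hx
  refine (norm_sum_le _ _).trans (Finset.sum_le_sum fun k _ => ?_)
  rw [norm_mul, Real.norm_of_nonneg (hx k).1]
  exact mul_le_of_le_one_right (norm_nonneg _) (hx k).2

lemma convexOrderLE_maxConvexLaw {n : ℕ} {h α : Fin n → ℝ} (hh : ∀ k, 0 ≤ h k)
    (hα_mem : ∀ k, α k ∈ Set.Icc (0 : ℝ) 1) (hα_anti : Antitone α)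
    {ν : Measure ℝ} (hν : ν ∈ feasibleEquivInputs h α) :
    ConvexOrderLE ν (maxConvexLaw h α) := by
  obtain ⟨P, hP, rfl⟩ := hν
  have := hP.isProbabilityMeasure
  intro f hf hint _
  have hsum : Integrable (fun x : Fin n → ℝ =>
      ∑ k : Fin n, x k * (f (cumGain h (k + 1)) - f (cumGain h k))) P :=
    integrable_finsetSum _ fun k _ => (hP.integrable_apply k).mul_const _
  rw [integral_map (measurable_equivInput h).aemeasurable hint.aestronglyMeasurable,
    integral_maxConvexLaw h hα_mem hα_anti, sum_extMean_decrement_mul α fun k => f (cumGain h k)]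
  calc ∫ x, f (equivInput h x) ∂P
      ≤ ∫ x, (f 0 + ∑ k : Fin n, x k * (f (cumGain h (k + 1)) - f (cumGain h k))) ∂P := by
        refine integral_mono_ae (hint.comp_measurable (measurable_equivInput h))
          ((integrable_const _).add hsum) ?_
        filter_upwards [hP.mem_unit] with x hx using hf.equivInput_le hh hx
    _ = _ := by
        rw [integral_add (integrable_const _) hsum,
          integral_finsetSum _ fun k _ => (hP.integrable_apply k).mul_const _]
        simp [integral_mul_const, hP.mean_eq, cumGain]

lemma variance_map_equivInput {n : ℕ} {α : Fin n → ℝ} {P : Measure (Fin n → ℝ)}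
    (hP : IsECFeasible α P) (h : Fin n → ℝ) :
    variance id (P.map (equivInput h)) =
      ∫ s, (s - ∑ k, h k * α k) ^ 2 ∂(P.map (equivInput h)) := by
  have hm := (measurable_equivInput h).aemeasurable (μ := P)
  rw [variance_eq_integral aemeasurable_id]
  simp only [id]
  rw [integral_map hm (f := fun x => x) aestronglyMeasurable_id, hP.integral_equivInput]

/-- The convex order applied to `s ↦ (s - m)²`, with `m` the common mean of the feasible
equivalent inputs. -/
lemma integral_sub_sq_le_vMaxE {n : ℕ} {h α : Fin n → ℝ} (hh : ∀ k, 0 ≤ h k)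
    (hα_mem : ∀ k, α k ∈ Set.Icc (0 : ℝ) 1) (hα_anti : Antitone α)
    {P : Measure (Fin n → ℝ)} (hP : IsECFeasible α P) :
    ∫ s, (s - ∑ k, h k * α k) ^ 2 ∂(P.map (equivInput h)) ≤ vMaxE h α := by
  have hint : ∀ {P' : Measure (Fin n → ℝ)}, IsECFeasible α P' →
      Integrable (fun s => (s - ∑ k, h k * α k) ^ 2) (P'.map (equivInput h)) := by
    intro P' hP'
    have := hP'.isProbabilityMeasure
    rw [integrable_map_measure (by fun_prop) (measurable_equivInput h).aemeasurable]
    exact ((hP'.memLp_equivInput h 2).sub (memLp_const _)).integrable_sq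
  rw [← integral_sub_sq_maxConvexLaw h hα_mem hα_anti]
  refine convexOrderLE_maxConvexLaw hh hα_mem hα_anti ⟨P, hP, rfl⟩ _ ?_ (hint hP) ?_
  · simpa [sub_eq_add_neg, Function.comp_def] using
      (even_two.convexOn_pow (𝕜 := ℝ)).translate_left (-∑ k, h k * α k)
  · rw [← map_comonotoneLaw]
    exact hint (isECFeasible_comonotoneLaw hα_mem hα_anti)

/-! ### Mutual information -/

/-- The product of the marginals is, among the product measures `ρ.fst.prod Q`, the one closest to
`ρ` in relative entropy. -/
lemma mutualInformation_le_klDiv {A B : Type*} [MeasurableSpace A] [StandardBorelSpace A]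
    [Nonempty A] [MeasurableSpace B] (ρ : Measure (A × B)) [IsProbabilityMeasure ρ]
    (Q : Measure B) [IsProbabilityMeasure Q] :
    mutualInformation ρ ≤ InformationTheory.klDiv ρ (ρ.fst.prod Q) := by
  set τ := ρ.map Prod.swap with hτ
  have : IsProbabilityMeasure τ := Measure.isProbabilityMeasure_map measurable_swap.aemeasurable
  have hfst : τ.fst = ρ.snd := Measure.fst_map_swap
  have hback : τ.map Prod.swap = ρ := by
    rw [hτ, Measure.map_map measurable_swap measurable_swap]
    simp
  -- Disintegrate `ρ` over its second marginal; the chain rule then splits off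
  -- `klDiv ρ.snd Q ≥ 0`.
  have hchain := InformationTheory.klDiv_compProd_eq_add τ.fst Q τ.condKernel
    (Kernel.const B ρ.fst)
  rw [Measure.disintegrate, Measure.compProd_const, Measure.compProd_const, hfst] at hchain
  calc mutualInformation ρ
      = InformationTheory.klDiv (τ.map Prod.swap) ((ρ.snd.prod ρ.fst).map Prod.swap) := by
        rw [hback, Measure.prod_swap, mutualInformation]
    _ ≤ InformationTheory.klDiv τ (ρ.snd.prod ρ.fst) :=
        InformationTheory.klDiv_map_le _ _ measurable_swap
    _ ≤ InformationTheory.klDiv τ (Q.prod ρ.fst) := by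
        rw [hchain]; exact le_add_self
    _ = InformationTheory.klDiv (ρ.map Prod.swap) ((ρ.fst.prod Q).map Prod.swap) := by
        rw [Measure.prod_swap]
    _ ≤ _ := InformationTheory.klDiv_map_le _ _ measurable_swap

/-- Relative entropy with respect to a measure having an exponential density. -/
lemma klDiv_withDensity_exp {A : Type*} [MeasurableSpace A] (μ : Measure A)
    [IsProbabilityMeasure μ] {g : A → ℝ} (hg : Measurable g)
    [IsProbabilityMeasure (μ.withDensity fun x => ENNReal.ofReal (Real.exp (g x)))]
    (hint : Integrable g (μ.withDensity fun x => ENNReal.ofReal (Real.exp (g x)))) :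
    InformationTheory.klDiv (μ.withDensity fun x => ENNReal.ofReal (Real.exp (g x))) μ =
      ENNReal.ofReal (∫ x, g x ∂(μ.withDensity fun x => ENNReal.ofReal (Real.exp (g x)))) := by
  set ρ := μ.withDensity fun x => ENNReal.ofReal (Real.exp (g x)) with hρ
  have hac : ρ ≪ μ := withDensity_absolutelyContinuous _ _
  have hllr : llr ρ μ =ᵐ[ρ] g := by
    filter_upwards [hac (Measure.rnDeriv_withDensity μ
      (f := fun x => ENNReal.ofReal (Real.exp (g x))) (by fun_prop))] with x hx
    rw [llr, hρ, hx, ENNReal.toReal_ofReal (Real.exp_pos _).le, Real.log_exp]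
  rw [InformationTheory.klDiv_of_ac_of_integrable hac (hint.congr hllr.symm),
    integral_congr_ae hllr]
  simp

/-! ### The Gaussian channel -/

/-- The logarithm of the density of `N(s, v)` with respect to `N(m, w)`. -/
noncomputable def gaussianLogRatio (m : ℝ) (v w : NNReal) (s y : ℝ) : ℝ :=
  1 / 2 * Real.log (w / v) + (y - m) ^ 2 / (2 * w) - (y - s) ^ 2 / (2 * v)

lemma gaussianPDFReal_eq_exp_mul (m : ℝ) {v w : NNReal} (hv : v ≠ 0) (hw : w ≠ 0) (s y : ℝ) :
    gaussianPDFReal s v y =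
      Real.exp (gaussianLogRatio m v w s y) * gaussianPDFReal m w y := by
  have hv' : (0 : ℝ) < v := by positivity
  have hw' : (0 : ℝ) < w := by positivity
  have hlog : Real.exp (1 / 2 * Real.log (w / v)) = √w / √v := by
    rw [mul_comm, Real.exp_mul, Real.exp_log (by positivity), ← Real.sqrt_eq_rpow,
      Real.sqrt_div hw'.le]
  have : gaussianLogRatio m v w s y = 1 / 2 * Real.log (w / v) +
      (-(y - s) ^ 2 / (2 * v) - (-(y - m) ^ 2 / (2 * w))) := by
    unfold gaussianLogRatio; ring
  rw [this, Real.exp_add, Real.exp_sub, hlog, gaussianPDFReal, gaussianPDFReal,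
    Real.sqrt_mul (by positivity) (v : ℝ), Real.sqrt_mul (by positivity) (w : ℝ)]
  have : 0 < √(2 * Real.pi) := by positivity
  have : 0 < √(w : ℝ) := by positivity
  have : 0 < √(v : ℝ) := by positivity
  generalize √(2 * Real.pi) = c at *
  field_simp

lemma jointLaw_eq_map {n : ℕ} (h : Fin n → ℝ) {σ : ℝ} (P : Measure (Fin n → ℝ)) {v : NNReal}
    (hv : (v : ℝ) = σ ^ 2) :
    jointLaw h σ P =
      (P.prod (gaussianReal 0 v)).map (fun p => (p.1, equivInput h p.1 + p.2)) := by
  obtain rfl : v = ⟨σ ^ 2, sq_nonneg σ⟩ := NNReal.eq hv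
  rfl

/-- The channel law has an explicit density with respect to the input law times any Gaussian. -/
lemma jointLaw_eq_withDensity {n : ℕ} (h : Fin n → ℝ) {σ : ℝ} (hσ : 0 < σ)
    (P : Measure (Fin n → ℝ)) [IsProbabilityMeasure P] (m : ℝ) {v w : NNReal}
    (hvσ : (v : ℝ) = σ ^ 2) (hw : w ≠ 0) :
    jointLaw h σ P = (P.prod (gaussianReal m w)).withDensity fun p =>
      ENNReal.ofReal (Real.exp (gaussianLogRatio m v w (equivInput h p.1) p.2)) := by
  have hv : v ≠ 0 := by
    rw [← NNReal.coe_ne_zero, hvσ]; exact (pow_pos hσ 2).ne'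
  have hmeas := measurable_equivInput h
  have hden : Measurable fun p : (Fin n → ℝ) × ℝ =>
      ENNReal.ofReal (Real.exp (gaussianLogRatio m v w (equivInput h p.1) p.2)) := by
    unfold gaussianLogRatio; fun_prop
  refine Measure.ext_of_lintegral _ fun F hF => ?_
  rw [jointLaw_eq_map h P hvσ, lintegral_map hF (by fun_prop), lintegral_prod _ (by fun_prop),
    lintegral_withDensity_eq_lintegral_mul _ hden hF, lintegral_prod _ (by fun_prop)]
  refine lintegral_congr fun x => ?_
  calc ∫⁻ z, F (x, equivInput h x + z) ∂(gaussianReal 0 v)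
      = ∫⁻ y, F (x, y) ∂(gaussianReal (equivInput h x) v) := by
        conv_rhs => rw [← zero_add (equivInput h x), ← gaussianReal_map_const_add]
        rw [lintegral_map (by fun_prop) (by fun_prop)]
    _ = ∫⁻ y, gaussianPDF (equivInput h x) v y * F (x, y) := by
        rw [gaussianReal_of_var_ne_zero _ hv, lintegral_withDensity_eq_lintegral_mul _
          (measurable_gaussianPDF _ _) (by fun_prop)]
        rfl
    _ = ∫⁻ y, gaussianPDF m w y * (ENNReal.ofReal (Real.exp
          (gaussianLogRatio m v w (equivInput h x) y)) * F (x, y)) := by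
        refine lintegral_congr fun y => ?_
        rw [gaussianPDF, gaussianPDF, gaussianPDFReal_eq_exp_mul m hv hw,
          ENNReal.ofReal_mul (Real.exp_pos _).le]
        ring
    _ = _ := by
        rw [gaussianReal_of_var_ne_zero _ hw, lintegral_withDensity_eq_lintegral_mul _
          (measurable_gaussianPDF _ _) (by fun_prop)]
        rfl

lemma fst_jointLaw {n : ℕ} (h : Fin n → ℝ) (σ : ℝ) (P : Measure (Fin n → ℝ))
    [IsProbabilityMeasure P] : (jointLaw h σ P).fst = P := by
  have hmeas := measurable_equivInput h
  rw [jointLaw_eq_map h P (v := (σ ^ 2).toNNReal) (Real.coe_toNNReal _ (sq_nonneg σ)),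
    Measure.fst_map_prodMk (by fun_prop)]
  exact Measure.fst_prod

lemma isProbabilityMeasure_jointLaw {n : ℕ} (h : Fin n → ℝ) (σ : ℝ) (P : Measure (Fin n → ℝ))
    [IsProbabilityMeasure P] : IsProbabilityMeasure (jointLaw h σ P) := by
  have hmeas := measurable_equivInput h
  rw [jointLaw_eq_map h P (v := (σ ^ 2).toNNReal) (Real.coe_toNNReal _ (sq_nonneg σ))]
  exact Measure.isProbabilityMeasure_map (by fun_prop)

/-- The mean of the log-density ratio under the channel law, by direct computation with the
moments of the input and of the noise. -/
lemma integrable_and_integral_gaussianLogRatio_jointLaw {n : ℕ} {h α : Fin n → ℝ} {σ : ℝ}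
    (hσ : 0 < σ) {P : Measure (Fin n → ℝ)} (hP : IsECFeasible α P) {v w : NNReal}
    (hv : (v : ℝ) = σ ^ 2) (hw : w ≠ 0) :
    Integrable (fun p => gaussianLogRatio (∑ k, h k * α k) v w
      (equivInput h p.1) p.2) (jointLaw h σ P) ∧
    ∫ p, gaussianLogRatio (∑ k, h k * α k) v w
      (equivInput h p.1) p.2 ∂(jointLaw h σ P) =
      1 / 2 * Real.log (w / σ ^ 2) +
        (∫ s, (s - ∑ k, h k * α k) ^ 2 ∂(P.map (equivInput h)) + σ ^ 2) / (2 * w) - 1 / 2 := by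
  have := hP.isProbabilityMeasure
  have hmeas := measurable_equivInput h
  set m := ∑ k, h k * α k with hm
  have hσ2 : (0 : ℝ) < σ ^ 2 := by positivity
  have hw' : (0 : ℝ) < w := by positivity
  set S : (Fin n → ℝ) → ℝ := fun x => equivInput h x - m with hS
  have hSL : MemLp S 2 P := (hP.memLp_equivInput h 2).sub (memLp_const _)
  have hSint : Integrable S P := hSL.integrable (by norm_num)
  have hZL : MemLp (fun z : ℝ => z) 2 (gaussianReal 0 v) := memLp_id_gaussianReal' 2 (by simp)
  have hZint : Integrable (fun z : ℝ => z) (gaussianReal 0 v) := hZL.integrable (by norm_num)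
  have hS1 : ∫ x, S x ∂P = 0 := by
    rw [integral_sub ((hP.memLp_equivInput h 1).integrable le_rfl) (integrable_const _),
      hP.integral_equivInput]
    simp [hm]
  have hZ1 : ∫ z, z ∂(gaussianReal 0 v) = 0 := integral_id_gaussianReal
  have hZ2 : ∫ z, z ^ 2 ∂(gaussianReal 0 v) = σ ^ 2 := by
    have := variance_fun_id_gaussianReal (μ := 0) (v := v)
    rw [variance_eq_integral (by fun_prop), hZ1] at this
    simpa [hv] using this
  have hS2 : ∫ s, (s - m) ^ 2 ∂(P.map (equivInput h)) = ∫ x, S x ^ 2 ∂P :=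
    integral_map hmeas.aemeasurable (by fun_prop)
  -- In terms of `(x, z)` the log-ratio is a quadratic polynomial in `S x` and `z`.
  have hform : ∀ p : (Fin n → ℝ) × ℝ,
      gaussianLogRatio m v w (equivInput h p.1) (equivInput h p.1 + p.2) =
        1 / 2 * Real.log (w / σ ^ 2) + S p.1 ^ 2 / (2 * w) + S p.1 * p.2 * (1 / w) +
          p.2 ^ 2 * (1 / (2 * w) - 1 / (2 * σ ^ 2)) := by
    intro p
    simp only [gaussianLogRatio, hS, hv]
    field_simp
    ring
  have i1 : Integrable (fun p : (Fin n → ℝ) × ℝ => S p.1 ^ 2 / (2 * w))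
      (P.prod (gaussianReal 0 v)) := (hSL.integrable_sq.comp_fst _).div_const _
  have i2 : Integrable (fun p : (Fin n → ℝ) × ℝ => S p.1 * p.2 * (1 / w))
      (P.prod (gaussianReal 0 v)) := (hSint.mul_prod hZint).mul_const _
  have i3 : Integrable (fun p : (Fin n → ℝ) × ℝ => p.2 ^ 2 * (1 / (2 * w) - 1 / (2 * σ ^ 2)))
      (P.prod (gaussianReal 0 v)) := (hZL.integrable_sq.comp_snd _).mul_const _
  have hgm : Measurable fun p : (Fin n → ℝ) × ℝ =>
      gaussianLogRatio m v w (equivInput h p.1) p.2 := by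
    unfold gaussianLogRatio; fun_prop
  constructor
  · rw [jointLaw_eq_map h P hv, integrable_map_measure hgm.aestronglyMeasurable (by fun_prop)]
    simp only [Function.comp_def, hform]
    exact (((integrable_const _).add i1).add i2).add i3
  · rw [jointLaw_eq_map h P hv, integral_map (by fun_prop) hgm.aestronglyMeasurable]
    simp only [hform]
    have e0 := integral_add (((integrable_const (1 / 2 * Real.log (w / σ ^ 2))).add i1).add i2) i3
    have e1 := integral_add ((integrable_const (1 / 2 * Real.log (w / σ ^ 2))).add i1) i2
    have e2 := integral_add (integrable_const (1 / 2 * Real.log (w / σ ^ 2))) i1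
    simp only [Pi.add_apply] at e0 e1 e2
    have c1 : ∫ p, S p.1 ^ 2 / (2 * w) ∂(P.prod (gaussianReal 0 v)) =
        (∫ x, S x ^ 2 ∂P) / (2 * w) := by
      rw [integral_div, integral_fun_fst (fun x => S x ^ 2)]
      simp
    have c2 : ∫ p, S p.1 * p.2 * (1 / w) ∂(P.prod (gaussianReal 0 v)) = 0 := by
      rw [integral_mul_const, integral_prod_mul S (fun z : ℝ => z), hS1, zero_mul, zero_mul]
    have c3 : ∫ p, p.2 ^ 2 * (1 / (2 * w) - 1 / (2 * σ ^ 2)) ∂(P.prod (gaussianReal 0 v)) =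
        σ ^ 2 * (1 / (2 * w) - 1 / (2 * σ ^ 2)) := by
      rw [integral_mul_const, integral_fun_snd (fun z : ℝ => z ^ 2), hZ2]
      simp
    rw [e0, e1, e2, c1, c2, c3, hS2]
    simp only [integral_const, probReal_univ, smul_eq_mul, one_mul, add_zero]
    field_simp
    ring

/-- The Gaussian bound on mutual information, for any upper bound `V` on the variance of the
equivalent input. -/
lemma mutualInformation_jointLaw_le {n : ℕ} {h α : Fin n → ℝ} {σ : ℝ}
    (hσ : 0 < σ) {P : Measure (Fin n → ℝ)} (hP : IsECFeasible α P) {V : ℝ}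
    (hV : ∫ s, (s - ∑ k, h k * α k) ^ 2 ∂(P.map (equivInput h)) ≤ V) :
    mutualInformation (jointLaw h σ P) ≤
      ENNReal.ofReal (1 / 2 * Real.log (1 + V / σ ^ 2)) := by
  have := hP.isProbabilityMeasure
  have hmeas := measurable_equivInput h
  have := isProbabilityMeasure_jointLaw h σ P
  have hV0 : 0 ≤ V := (integral_nonneg fun s => sq_nonneg _).trans hV
  have hσ2 : (0 : ℝ) < σ ^ 2 := by positivity
  have hpos : 0 < σ ^ 2 + V := by positivity
  set m := ∑ k, h k * α k with hm
  -- The comparison output law: Gaussian with the common mean and variance `σ² + V`.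
  obtain ⟨v, hv⟩ : ∃ v : NNReal, (v : ℝ) = σ ^ 2 := ⟨_, Real.coe_toNNReal _ hσ2.le⟩
  obtain ⟨w, hwv⟩ : ∃ w : NNReal, (w : ℝ) = σ ^ 2 + V := ⟨_, Real.coe_toNNReal _ hpos.le⟩
  have hw : w ≠ 0 := by
    rw [← NNReal.coe_ne_zero, hwv]; exact hpos.ne'
  have hden := jointLaw_eq_withDensity h hσ P m hv hw
  obtain ⟨hint, hval⟩ := integrable_and_integral_gaussianLogRatio_jointLaw (h := h) hσ hP hv hw
  have hgm : Measurable fun p : (Fin n → ℝ) × ℝ =>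
      gaussianLogRatio m v w (equivInput h p.1) p.2 := by
    unfold gaussianLogRatio; fun_prop
  have hkl : InformationTheory.klDiv (jointLaw h σ P) (P.prod (gaussianReal m w)) =
      ENNReal.ofReal (∫ p, gaussianLogRatio m v w
        (equivInput h p.1) p.2 ∂(jointLaw h σ P)) := by
    have hprob := isProbabilityMeasure_jointLaw h σ P
    rw [hden] at hint hprob ⊢
    exact klDiv_withDensity_exp _ hgm hint
  refine (mutualInformation_le_klDiv (jointLaw h σ P) (gaussianReal m w)).trans ?_
  rw [fst_jointLaw, hkl, hval, hwv]
  refine ENNReal.ofReal_le_ofReal ?_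
  have e : (σ ^ 2 + V) / σ ^ 2 = 1 + V / σ ^ 2 := by field_simp
  have hq : (∫ s, (s - m) ^ 2 ∂(P.map (equivInput h)) + σ ^ 2) / (2 * (σ ^ 2 + V)) ≤ 1 / 2 := by
    rw [div_le_iff₀ (by positivity)]
    linarith
  rw [e]
  linarith

theorem theorem5 {n : ℕ} (h α : Fin n → ℝ) (σ : ℝ)
    (h_pos : ∀ k, 0 < h k) (h_sum : ∑ k, h k = 1)
    (hα_mem : ∀ k, α k ∈ Set.Icc (0 : ℝ) 1) (hα_anti : Antitone α) (hσ : 0 < σ) :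
    ecCapacity h α σ ≤ ENNReal.ofReal (1 / 2 * Real.log (1 + vMaxE h α / σ ^ 2)) ∧
    IsGreatest {v : ℝ | ∃ ν ∈ feasibleEquivInputs h α, v = variance id ν} (vMaxE h α) ∧
    maxConvexLaw h α ∈ feasibleEquivInputs h α ∧
    variance id (maxConvexLaw h α) = vMaxE h α ∧
    (∀ ν ∈ feasibleEquivInputs h α, ConvexOrderLE ν (maxConvexLaw h α)) := by
  have hh : ∀ k, 0 ≤ h k := fun k => (h_pos k).le
  have hmem := maxConvexLaw_mem_feasibleEquivInputs h hα_mem hα_anti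
  have hvar : variance id (maxConvexLaw h α) = vMaxE h α := by
    rw [← integral_sub_sq_maxConvexLaw h hα_mem hα_anti, ← map_comonotoneLaw]
    exact variance_map_equivInput (isECFeasible_comonotoneLaw hα_mem hα_anti) h
  refine ⟨iSup₂_le fun P hP => mutualInformation_jointLaw_le hσ hP
      (integral_sub_sq_le_vMaxE hh hα_mem hα_anti hP), ⟨⟨_, hmem, hvar.symm⟩, ?_⟩, hmem, hvar,
    fun ν hν => convexOrderLE_maxConvexLaw hh hα_mem hα_anti hν⟩
  rintro _ ⟨_, ⟨P, hP, rfl⟩, rfl⟩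
  rw [variance_map_equivInput hP]
  exact integral_sub_sq_le_vMaxE hh hα_mem hα_anti hP
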